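/- Let $K$ be a field, $S=K[x_1,\dots,x_n]$ with its standard grading, and let $I\subseteq S$ be a nonzero monomial ideal. Let $G(I)$ be the minimal set of monomial generators of $I$, let $\deg(I)$ be the highest degree of a monomial of $G(I)$, and put $m(u)=\max\{i : x_i\mid u\}$ for a monomial $u$ (with $m(1)=0$) and $m(I)=\max_{u\in G(I)}m(u)$. Let $\operatorname{reg}(I)=\max\{j-i : \beta_{ij}(I)\neq 0\}$ be the Castelnuovo--Mumford regularity of $I$, where the graded Betti number $\beta_{ij}(I)$ is the number of basis elements of degree $j$ in the $i$-th module of a minimal graded free resolution of $I$ over $S$. If $I$ is of Borel type, that is, if $(I:x_j^\infty)=(I:(x_1,\dots,x_j)^\infty)$ for all $j=1,\dots,n$, then $$\operatorname{reg}(I)\le m(I)\,(\deg(I)-1)+1 .$$ -/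

import Mathlib

open MvPolynomial

namespace BorelReg

variable {K : Type*} [Field K] {n : ℕ}

/-- `I` is a monomial ideal: it is generated by monomials. -/
def IsMonomialIdeal (I : Ideal (MvPolynomial (Fin n) K)) : Prop :=
  ∃ A : Set (Fin n →₀ ℕ), I = Ideal.span ((fun a => monomial a (1 : K)) '' A)

/-- The exponents of the monomials in `G(I)`, the minimal set of monomial generators of `I`:
the monomials of `I` that are minimal for divisibility (the pointwise order on exponents). -/
def minGens (I : Ideal (MvPolynomial (Fin n) K)) : Set (Fin n →₀ ℕ) :=
  {a | Minimal (fun b => monomial b (1 : K) ∈ I) a}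

/-- `deg(I)`, the highest degree of a monomial of `G(I)`. (`G(I)` is always finite.) -/
noncomputable def degI (I : Ideal (MvPolynomial (Fin n) K)) : ℕ :=
  sSup ((fun a : Fin n →₀ ℕ => a.degree) '' minGens I)

/-- `m(u) = max {i | x_i ∣ u}` for `u = x ^ a`, with `x_1, …, x_n` numbered from `1`, so that
`X i` is `x_{i+1}`; `m(1) = 0`. -/
def mMon (a : Fin n →₀ ℕ) : ℕ := a.support.sup fun i => (i : ℕ) + 1

/-- `m(I) = max_{u ∈ G(I)} m(u)`. -/
noncomputable def mI (I : Ideal (MvPolynomial (Fin n) K)) : ℕ :=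
  sSup (mMon '' minGens I)

/-- `(I : J^∞) = ⋃_k (I : J^k)`; the union is increasing, so it is the supremum. -/
noncomputable def saturation (I J : Ideal (MvPolynomial (Fin n) K)) : Ideal (MvPolynomial (Fin n) K) :=
  ⨆ k : ℕ, I.colon ((J ^ k : Ideal (MvPolynomial (Fin n) K)) : Set (MvPolynomial (Fin n) K))

/-- A monomial ideal `I` is of Borel type if `(I : x_j^∞) = (I : (x_1, …, x_j)^∞)` for all `j`. -/
def IsBorelType (I : Ideal (MvPolynomial (Fin n) K)) : Prop :=
  IsMonomialIdeal I ∧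
    ∀ j : Fin n, saturation I (Ideal.span {X j}) = saturation I (Ideal.span (X '' Set.Iic j))

/-- A vector of the graded free module `⨁_b S(-w b)` is homogeneous of degree `d`. -/
def IsHomogeneousVec {r : ℕ} (w : Fin r → ℤ) (v : Fin r → MvPolynomial (Fin n) K) (d : ℤ) : Prop :=
  ∀ b, ∀ e ∈ (v b).support, (e.degree : ℤ) + w b = d

/-- A minimal graded free resolution `⋯ → F_1 → F_0 → I → 0` of the ideal `I` over
`S = K[x_1, …, x_n]`, where `F_i = ⨁_a S(-w_i(a))` is free of finite rank, with its basis
vector number `a` in degree `w_i(a)`, and all maps are homogeneous of degree `0`. -/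
structure MinGradedFreeRes (I : Ideal (MvPolynomial (Fin n) K)) where
  rank : ℕ → ℕ
  w : ∀ i, Fin (rank i) → ℤ
  d : ∀ i, (Fin (rank (i + 1)) → MvPolynomial (Fin n) K) →ₗ[MvPolynomial (Fin n) K]
    (Fin (rank i) → MvPolynomial (Fin n) K)
  aug : (Fin (rank 0) → MvPolynomial (Fin n) K) →ₗ[MvPolynomial (Fin n) K] I
  d_homogeneous : ∀ i a, IsHomogeneousVec (w i) (d i (Pi.single a 1)) (w (i + 1) a)
  aug_homogeneous : ∀ a, ∀ e ∈ (aug (Pi.single a 1) : MvPolynomial (Fin n) K).support,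
    (e.degree : ℤ) = w 0 a
  aug_surjective : Function.Surjective aug
  exact_zero : Function.Exact (d 0) aug
  exact_succ : ∀ i, Function.Exact (d (i + 1)) (d i)
  /-- Minimality: the image of `F_{i+1}` lies in `(x_1, …, x_n) F_i`. -/
  minimal : ∀ i v b, d i v b ∈ Ideal.span (Set.range (X : Fin n → MvPolynomial (Fin n) K))

/-- The graded Betti number `β_{ij}(I)`: the number of basis vectors of degree `j` in the `i`-th
module of a minimal graded free resolution. -/
def MinGradedFreeRes.betti {I : Ideal (MvPolynomial (Fin n) K)} (F : MinGradedFreeRes I)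
    (i : ℕ) (j : ℤ) : ℕ :=
  Fintype.card {a : Fin (F.rank i) // F.w i a = j}

/-- `r = reg(I) = max {j - i | β_{ij}(I) ≠ 0}`, as read off from the resolution `F`. -/
def MinGradedFreeRes.IsReg {I : Ideal (MvPolynomial (Fin n) K)} (F : MinGradedFreeRes I)
    (r : ℤ) : Prop :=
  IsGreatest {t : ℤ | ∃ (i : ℕ) (j : ℤ), F.betti i j ≠ 0 ∧ t = j - i} r

end BorelReg

/-!
Write `m = m(I)`, `δ = deg(I)` and `ρ = m (δ - 1) + 1`.

For `I` of Borel type, multiplication by `x_k` on `S/(I, x_{k+1}, …, x_n)` is injective in degrees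
`≥ ρ`. Indeed, let `u ∉ I` be a monomial in `x_1, …, x_k` with `x_k u ∈ I`. The generator of `I`
dividing `x_k u` involves `x_k`, so `k ≤ m`, and if `deg u ≥ ρ`, some `x_i` with `i ≤ k` occurs in
`u` with exponent at least `δ`. Borel type allows the power of `x_k` in that generator to be traded
for a power of `x_i`, and a power larger than the `δ`-th is irrelevant to membership in `I`;
hence `u ∈ I` after all.

Let `P` be the resolution of `S/I` that extends a minimal resolution `F` of `I`, so that
`P_{i+1} = F_i`. Dividing out `x_n, …, x_1` one at a time, the injectivity above propagates the
exactness of `P` to `P/(x_k, …, x_n) P`, at `P_{i+1}` in degrees `> ρ + i`. Once all the variables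
are gone, minimality makes the differentials zero, so `F_i` has no basis vector of degree `> ρ + i`.
-/

namespace BorelReg

section LinearAlgebra

variable {R : Type*} {m : ℕ}

theorem mem_smul_top_iff_forall_mem [CommSemiring R] {ι : Type*} [Finite ι] {J : Ideal R}
    {v : ι → R} :
    v ∈ (J • ⊤ : Submodule R (ι → R)) ↔ ∀ i, v i ∈ J := by
  classical
  cases nonempty_fintype ι
  constructor
  · have hle : J • ⊤ ≤ Submodule.pi Set.univ fun _ : ι => J :=
      Submodule.smul_le.2 fun c hc v _ i _ => J.mul_mem_right (v i) hc
    exact fun hv i => hle hv i (Set.mem_univ i)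
  · intro hv
    rw [pi_eq_sum_univ' v]
    exact Submodule.sum_mem _ fun i _ => Submodule.smul_mem_smul (hv i) Submodule.mem_top

theorem span_range_removeNth_eq_of_sum_smul_eq_zero [Ring R] {M : Type*} [AddCommGroup M]
    [Module R M] {z : Fin (m + 1) → M} {c : Fin (m + 1) → R} (a : Fin (m + 1))
    (hsum : ∑ b, c b • z b = 0) (ha : IsUnit (c a)) :
    Submodule.span R (Set.range (a.removeNth z)) = Submodule.span R (Set.range z) := by
  have hza : z a ∈ Submodule.span R (Set.range (a.removeNth z)) := by
    rw [← Submodule.smul_mem_iff_of_isUnit _ ha]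
    rw [Fin.sum_univ_succAbove _ a] at hsum
    rw [eq_neg_of_add_eq_zero_left hsum]
    exact neg_mem (sum_mem fun b _ => Submodule.smul_mem _ _ (Submodule.subset_span ⟨b, rfl⟩))
  rw [← Submodule.span_insert_eq_span hza]
  conv_rhs => rw [← Fin.insertNth_self_removeNth a z, Fin.range_insertNth]
  rfl

theorem directed_colon_pow [CommSemiring R] (I J : Ideal R) :
    Directed (· ≤ ·) fun m : ℕ => I.colon ((J ^ m : Ideal R) : Set R) :=
  Monotone.directed_le fun _ _ hab => Submodule.colon_mono le_rfl (Ideal.pow_le_pow_right hab)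

end LinearAlgebra

section Polynomial

variable {σ R : Type*}

theorem weight_one_eq_degree (e : σ →₀ ℕ) : Finsupp.weight (1 : σ → ℤ) e = (e.degree : ℤ) := by
  simp [Finsupp.weight_apply, Finsupp.sum, Finsupp.degree_apply]

theorem mem_idealOfVars_iff_coeff_zero [CommSemiring R] {f : MvPolynomial σ R} :
    f ∈ idealOfVars σ R ↔ coeff 0 f = 0 := by
  rw [← pow_one (idealOfVars σ R), mem_pow_idealOfVars_iff']
  simp [Finsupp.degree_eq_zero_iff]

theorem weightedHomogeneousComponent_one_zero [CommSemiring R] (f : MvPolynomial σ R) :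
    weightedHomogeneousComponent (1 : σ → ℤ) 0 f = C (coeff 0 f) := by
  classical
  ext e
  simp only [coeff_weightedHomogeneousComponent, weight_one_eq_degree, coeff_C, Nat.cast_eq_zero,
    Finsupp.degree_eq_zero_iff, eq_comm (a := e)]
  split_ifs with h
  · rw [h]
  · rfl

theorem weightedHomogeneousComponent_mul_of_right [CommSemiring R] {M : Type*} [AddCommGroup M]
    {w : σ → M} {s : M} (t : M) (f : MvPolynomial σ R) {g : MvPolynomial σ R}
    (hg : g.IsWeightedHomogeneous w s) :
    weightedHomogeneousComponent w t (f * g) = weightedHomogeneousComponent w (t - s) f * g := by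
  classical
  let _ := weightedGradedAlgebra R w
  have h := DirectSum.coe_decompose_mul_add_of_right_mem (weightedHomogeneousSubmodule R w)
    (i := t - s) (a := f) hg
  rw [sub_add_cancel] at h
  simp only [← weightedDecomposition.decompose'_apply]
  exact h

theorem mem_span_X_image_of_X_mul_mem [CommSemiring R] {s : Set σ} {k : σ} (hk : k ∉ s)
    {f : MvPolynomial σ R} (h : X k * f ∈ Ideal.span (X '' s)) : f ∈ Ideal.span (X '' s) := by
  rw [mem_ideal_span_X_image] at h ⊢
  intro e he
  obtain ⟨l, hl, hne⟩ := h (Finsupp.single k 1 + e) (by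
    rwa [mem_support_iff, coeff_X_mul, ← mem_support_iff])
  have hlk : l ≠ k := fun hlk => hk (hlk ▸ hl)
  exact ⟨l, hl, by simpa [Finsupp.single_eq_of_ne hlk] using hne⟩

theorem monomial_mem_of_le [CommSemiring R] {I : Ideal (MvPolynomial σ R)} {a b : σ →₀ ℕ}
    (hab : a ≤ b) (ha : monomial a (1 : R) ∈ I) : monomial b (1 : R) ∈ I := by
  rw [← tsub_add_cancel_of_le hab, ← one_mul (1 : R), ← monomial_mul]
  exact I.mul_mem_left _ ha

theorem monomial_mem_span_monomial_image [CommSemiring R] [Nontrivial R] {A : Set (σ →₀ ℕ)}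
    {e : σ →₀ ℕ} :
    monomial e (1 : R) ∈ Ideal.span ((fun a => monomial a (1 : R)) '' A) ↔ ∃ a ∈ A, a ≤ e := by
  classical
  simp only [mem_ideal_span_monomial_image, support_monomial, one_ne_zero, if_false,
    Finset.mem_singleton, forall_eq]

end Polynomial

variable {K : Type*} [Field K] {n : ℕ}

local notation "S" => MvPolynomial (Fin n) K

section GradedFreeModule

variable {r s : ℕ} {w : Fin r → ℤ} {w' : Fin s → ℤ} {t : ℤ}

theorem isHomogeneousVec_iff {v : Fin r → S} :
    IsHomogeneousVec w v t ↔ ∀ b, (v b).IsWeightedHomogeneous (1 : Fin n → ℤ) (t - w b) := by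
  simp only [IsHomogeneousVec, IsWeightedHomogeneous, weight_one_eq_degree, mem_support_iff,
    eq_sub_iff_add_eq]

theorem isHomogeneousVec_add_const_iff {v : Fin r → S} {m : ℤ} :
    IsHomogeneousVec (fun b => w b + m) v t ↔ IsHomogeneousVec w v (t - m) := by
  simp only [IsHomogeneousVec, ← add_assoc, eq_sub_iff_add_eq]

theorem IsHomogeneousVec.sub {u v : Fin r → S} (hu : IsHomogeneousVec w u t)
    (hv : IsHomogeneousVec w v t) : IsHomogeneousVec w (u - v) t := by
  rw [isHomogeneousVec_iff] at *
  exact fun b => (weightedHomogeneousSubmodule K 1 _).sub_mem (hu b) (hv b)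

theorem IsHomogeneousVec.smul {f : S} {d : ℤ} (hf : f.IsWeightedHomogeneous (1 : Fin n → ℤ) d)
    {v : Fin r → S} (hv : IsHomogeneousVec w v t) : IsHomogeneousVec w (f • v) (d + t) := by
  rw [isHomogeneousVec_iff] at *
  intro b
  rw [add_sub_assoc]
  exact hf.mul (hv b)

theorem isHomogeneousVec_single (w : Fin r → ℤ) (a : Fin r) :
    IsHomogeneousVec w (Pi.single a (1 : S)) (w a) := by
  refine isHomogeneousVec_iff.2 fun b => ?_
  obtain rfl | hb := eq_or_ne b a
  · rw [Pi.single_eq_same, sub_self]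
    exact isWeightedHomogeneous_one K _
  · rw [Pi.single_eq_of_ne hb]
    exact isWeightedHomogeneous_zero K _ _

/-- The component of degree `t` of a vector of the graded free module `⨁_b S(-w b)`. -/
noncomputable def component (w : Fin r → ℤ) (t : ℤ) : (Fin r → S) →ₗ[K] (Fin r → S) :=
  LinearMap.pi fun b => weightedHomogeneousComponent (1 : Fin n → ℤ) (t - w b) ∘ₗ LinearMap.proj b

theorem component_apply (w : Fin r → ℤ) (t : ℤ) (v : Fin r → S) (b : Fin r) :
    component w t v b = weightedHomogeneousComponent (1 : Fin n → ℤ) (t - w b) (v b) :=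
  rfl

theorem isHomogeneousVec_component (w : Fin r → ℤ) (t : ℤ) (v : Fin r → S) :
    IsHomogeneousVec w (component w t v) t :=
  isHomogeneousVec_iff.2 fun _ => weightedHomogeneousComponent_isWeightedHomogeneous _ _

theorem IsHomogeneousVec.component_eq {v : Fin r → S} (hv : IsHomogeneousVec w v t) :
    component w t v = v :=
  funext fun b => (isHomogeneousVec_iff.1 hv b).weightedHomogeneousComponent_same

theorem exists_sum_component (w : Fin r → ℤ) (v : Fin r → S) :
    ∃ A : Finset ℤ, ∑ t ∈ A, component w t v = v := by
  refine ⟨Finset.univ.biUnion fun b => (v b).support.image fun e => (e.degree : ℤ) + w b, ?_⟩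
  ext b e
  simp only [Finset.sum_apply, coeff_sum, component_apply, coeff_weightedHomogeneousComponent,
    weight_one_eq_degree, eq_sub_iff_add_eq, Finset.sum_ite_eq, ite_eq_left_iff]
  contrapose!
  exact fun he => Finset.mem_biUnion.2 ⟨b, Finset.mem_univ b, Finset.mem_image_of_mem _
    (mem_support_iff.2 he.symm)⟩

/-- A homomorphism `⨁_a S(-w a) → ⨁_b S(-w' b)` of graded free modules, of degree `0`. -/
def IsHomogeneousMap (w : Fin r → ℤ) (w' : Fin s → ℤ) (φ : (Fin r → S) →ₗ[S] (Fin s → S)) : Prop :=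
  ∀ a, IsHomogeneousVec w' (φ (Pi.single a 1)) (w a)

theorem IsHomogeneousMap.map_component {φ : (Fin r → S) →ₗ[S] (Fin s → S)}
    (hφ : IsHomogeneousMap w w' φ) (t : ℤ) (v : Fin r → S) :
    φ (component w t v) = component w' t (φ v) := by
  ext1 b
  have hcoord (u : Fin r → S) : φ u b = ∑ a, u a * φ (Pi.single a 1) b := by
    conv_lhs => rw [pi_eq_sum_univ' u]
    simp [Finset.sum_apply]
  rw [component_apply, hcoord, hcoord, map_sum]
  refine Finset.sum_congr rfl fun a _ => ?_
  rw [weightedHomogeneousComponent_mul_of_right _ _ (isHomogeneousVec_iff.1 (hφ a) b),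
    component_apply, sub_sub_sub_cancel_right]

theorem IsHomogeneousMap.map {φ : (Fin r → S) →ₗ[S] (Fin s → S)} (hφ : IsHomogeneousMap w w' φ)
    {v : Fin r → S} (hv : IsHomogeneousVec w v t) : IsHomogeneousVec w' (φ v) t := by
  rw [← hv.component_eq, hφ.map_component]
  exact isHomogeneousVec_component _ _ _

theorem isHomogeneousMap_lsmul {x : S} {m : ℤ} (hx : x.IsWeightedHomogeneous (1 : Fin n → ℤ) m)
    (w : Fin r → ℤ) :
    IsHomogeneousMap (fun b => w b + m) w (LinearMap.lsmul S (Fin r → S) x) := fun a => by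
  beta_reduce
  rw [add_comm (w a)]
  exact (isHomogeneousVec_single w a).smul hx

/-- A submodule of `⨁_b S(-w b)` is graded if it contains the components of its elements. -/
def IsGradedSubmodule (w : Fin r → ℤ) (Z : Submodule S (Fin r → S)) : Prop :=
  ∀ t, ∀ v ∈ Z, component w t v ∈ Z

theorem IsHomogeneousMap.isGradedSubmodule_ker {φ : (Fin r → S) →ₗ[S] (Fin s → S)}
    (hφ : IsHomogeneousMap w w' φ) : IsGradedSubmodule w (LinearMap.ker φ) := fun t v hv => by
  rw [LinearMap.mem_ker] at hv ⊢
  rw [hφ.map_component, hv, map_zero]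

attribute [local instance] weightedGradedAlgebra in
theorem isGradedSubmodule_smul_top {J : Ideal S}
    (hJ : J.IsHomogeneous (weightedHomogeneousSubmodule K (1 : Fin n → ℤ))) (w : Fin r → ℤ) :
    IsGradedSubmodule w (J • ⊤ : Submodule S (Fin r → S)) := fun t v hv => by
  rw [mem_smul_top_iff_forall_mem] at hv ⊢
  exact fun b => weightedHomogeneousComponent_mem_of_mem _ _ hJ (hv b) _

theorem IsHomogeneousMap.exists_isHomogeneousVec_sub_mem
    {φ : (Fin r → S) →ₗ[S] (Fin s → S)} (hφ : IsHomogeneousMap w w' φ)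
    {Z : Submodule S (Fin s → S)} (hZ : IsGradedSubmodule w' Z) {v : Fin s → S}
    (hv : IsHomogeneousVec w' v t) (hmem : v ∈ LinearMap.range φ ⊔ Z) :
    ∃ y, IsHomogeneousVec w y t ∧ v - φ y ∈ Z := by
  obtain ⟨_, ⟨y, rfl⟩, z, hz, rfl⟩ := Submodule.mem_sup.1 hmem
  refine ⟨component w t y, isHomogeneousVec_component w t y, ?_⟩
  rw [hφ.map_component]
  nth_rw 1 [← hv.component_eq]
  rw [← map_sub, add_sub_cancel_left]
  exact hZ t z hz

end GradedFreeModule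

section MinimalCover

variable {r : ℕ} {w : Fin r → ℤ}

theorem IsGradedSubmodule.exists_generators {Z : Submodule S (Fin r → S)}
    (hZ : IsGradedSubmodule w Z) :
    ∃ (m : ℕ) (z : Fin m → Fin r → S) (u : Fin m → ℤ),
      (∀ a, IsHomogeneousVec w (z a) (u a)) ∧ Submodule.span S (Set.range z) = Z := by
  let G : Set (Fin r → S) := {v | v ∈ Z ∧ ∃ t, IsHomogeneousVec w v t}
  have hG : Submodule.span S G = Z := by
    refine le_antisymm (Submodule.span_le.2 fun v hv => hv.1) fun v hv => ?_
    obtain ⟨A, hA⟩ := exists_sum_component w v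
    rw [← hA]
    exact sum_mem fun t _ => Submodule.subset_span
      ⟨hZ t v hv, t, isHomogeneousVec_component w t v⟩
  have hfg : (Submodule.span S G).FG := IsNoetherian.noetherian _
  obtain ⟨B, hBG, hB⟩ := (Submodule.fg_span_iff_fg_span_finset_subset G).1 hfg
  choose u hu using fun a => (hBG (B.equivFin.symm a).2).2
  refine ⟨B.card, Subtype.val ∘ B.equivFin.symm, u, hu, ?_⟩
  rw [EquivLike.range_comp, Subtype.range_coe_subtype, ← hG, hB]
  rfl

theorem isHomogeneousMap_linearCombination {m : ℕ} {z : Fin m → Fin r → S} {u : Fin m → ℤ}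
    (hz : ∀ a, IsHomogeneousVec w (z a) (u a)) :
    IsHomogeneousMap u w (Fintype.linearCombination S z) := fun a => by
  rw [Fintype.linearCombination_apply_single, one_smul]
  exact hz a

theorem span_range_removeNth_eq_of_mem_ker {m : ℕ} {z : Fin (m + 1) → Fin r → S}
    {u : Fin (m + 1) → ℤ} (hz : ∀ a, IsHomogeneousVec w (z a) (u a)) {c : Fin (m + 1) → S}
    (hc : c ∈ LinearMap.ker (Fintype.linearCombination S z)) {a : Fin (m + 1)}
    (ha : c a ∉ idealOfVars (Fin n) K) :
    Submodule.span S (Set.range (a.removeNth z)) = Submodule.span S (Set.range z) := by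
  -- In the component of degree `u a` of the relation `c`, the coefficient of `z a` is a constant.
  have hrel := (isHomogeneousMap_linearCombination hz).isGradedSubmodule_ker (u a) c hc
  rw [LinearMap.mem_ker, Fintype.linearCombination_apply] at hrel
  refine span_range_removeNth_eq_of_sum_smul_eq_zero a hrel ?_
  rw [component_apply, sub_self, weightedHomogeneousComponent_one_zero]
  rw [mem_idealOfVars_iff_coeff_zero] at ha
  exact (isUnit_iff_ne_zero.2 ha).map C

/-- A minimal homogeneous cover of a submodule `Z` of `⨁_b S(-w b)`: a homogeneous map onto `Z`
from a graded free module, whose kernel consists of vectors with entries in `(x_1, …, x_n)`. -/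
structure MinimalCover (w : Fin r → ℤ) (Z : Submodule S (Fin r → S)) where
  rank : ℕ
  weight : Fin rank → ℤ
  map : (Fin rank → S) →ₗ[S] (Fin r → S)
  isHomogeneousMap : IsHomogeneousMap weight w map
  range_map : LinearMap.range map = Z
  ker_map_le : LinearMap.ker map ≤ idealOfVars (Fin n) K • ⊤

theorem IsGradedSubmodule.nonempty_minimalCover {Z : Submodule S (Fin r → S)}
    (hZ : IsGradedSubmodule w Z) : Nonempty (MinimalCover w Z) := by
  classical
  have hex := hZ.exists_generators
  obtain ⟨z, u, hz, hspan⟩ := Nat.find_spec hex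
  have hmin (m : ℕ) := Nat.find_min hex (m := m)
  generalize Nat.find hex = m at z u hz hspan hmin
  refine ⟨⟨m, u, Fintype.linearCombination S z, isHomogeneousMap_linearCombination hz,
    by rw [Fintype.range_linearCombination, hspan], fun c hc => ?_⟩⟩
  refine mem_smul_top_iff_forall_mem.2 fun a => ?_
  by_contra ha
  obtain _ | m := m
  · exact a.elim0
  · exact hmin m m.lt_succ_self ⟨a.removeNth z, a.removeNth u, fun b => hz _,
      (span_range_removeNth_eq_of_mem_ker hz hc ha).trans hspan⟩

end MinimalCover

section Existence

variable (K n) in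
/-- A graded submodule of a graded free module `⨁_b S(-w b)` of finite rank. -/
structure GradedSub where
  rank : ℕ
  w : Fin rank → ℤ
  carrier : Submodule S (Fin rank → S)
  isGraded : IsGradedSubmodule w carrier

namespace GradedSub

/-- A chosen minimal cover of `Z`. -/
noncomputable def cover (Z : GradedSub K n) : MinimalCover Z.w Z.carrier :=
  Classical.choice Z.isGraded.nonempty_minimalCover

/-- The first syzygy module of `Z`: the kernel of its chosen minimal cover. -/
noncomputable def syzygy (Z : GradedSub K n) : GradedSub K n where
  rank := Z.cover.rank
  w := Z.cover.weight
  carrier := LinearMap.ker Z.cover.map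
  isGraded := Z.cover.isHomogeneousMap.isGradedSubmodule_ker

/-- The `i`-th syzygy module of `Z`. -/
noncomputable def iterSyzygy (Z : GradedSub K n) : ℕ → GradedSub K n
  | 0 => Z
  | i + 1 => (Z.iterSyzygy i).syzygy

theorem exact_cover_syzygy (Z : GradedSub K n) : Function.Exact Z.syzygy.cover.map Z.cover.map :=
  LinearMap.exact_iff.2 Z.syzygy.cover.range_map.symm

end GradedSub

attribute [local instance] weightedGradedAlgebra in
theorem nonempty_minGradedFreeRes {I : Ideal S}
    (hI : I.IsHomogeneous (weightedHomogeneousSubmodule K (1 : Fin n → ℤ))) :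
    Nonempty (MinGradedFreeRes I) := by
  let Z : GradedSub K n := ⟨1, 0, I • ⊤, isGradedSubmodule_smul_top hI 0⟩
  have hmem (v) : Z.cover.map v 0 ∈ I := by
    have hv := LinearMap.mem_range_self Z.cover.map v
    rw [Z.cover.range_map] at hv
    exact mem_smul_top_iff_forall_mem.1 hv 0
  let aug : (Fin Z.cover.rank → S) →ₗ[S] I :=
    (LinearMap.proj 0 ∘ₗ Z.cover.map).codRestrict I hmem
  have haug (v) : aug v = 0 ↔ Z.cover.map v = 0 := by
    rw [Subtype.ext_iff, funext_iff, Fin.forall_fin_one]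
    rfl
  refine ⟨{
    rank i := (Z.iterSyzygy i).cover.rank
    w i := (Z.iterSyzygy i).cover.weight
    d i := (Z.iterSyzygy (i + 1)).cover.map
    aug := aug
    d_homogeneous i := (Z.iterSyzygy (i + 1)).cover.isHomogeneousMap
    aug_homogeneous a e he := ?_
    aug_surjective := fun ⟨f, hf⟩ => ?_
    exact_zero v := (haug v).trans (Z.exact_cover_syzygy v)
    exact_succ i := (Z.iterSyzygy (i + 1)).exact_cover_syzygy
    minimal i v b := ?_ }⟩
  · exact (add_zero _).symm.trans (Z.cover.isHomogeneousMap a 0 e he)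
  · have hf' : (fun _ => f) ∈ LinearMap.range Z.cover.map := by
      rw [Z.cover.range_map]
      exact mem_smul_top_iff_forall_mem.2 fun _ => hf
    obtain ⟨v, hv⟩ := hf'
    exact ⟨v, Subtype.ext (congrFun hv 0)⟩
  · exact mem_smul_top_iff_forall_mem.1 ((Z.iterSyzygy i).cover.ker_map_le
      (((Z.iterSyzygy i).exact_cover_syzygy _).2 ⟨v, rfl⟩)) b

end Existence

section TailIdeal

variable (K n) in
/-- The ideal `(x_{k+1}, …, x_n)`, generated by the variables `X l` with `k ≤ l`. -/
noncomputable def tailIdeal (k : ℕ) : Ideal S :=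
  Ideal.span (X '' {l : Fin n | k ≤ l})

theorem tailIdeal_self : tailIdeal K n n = ⊥ := by
  rw [tailIdeal, Ideal.span_eq_bot]
  rintro _ ⟨l, hl, rfl⟩
  exact absurd l.2 (not_lt.2 hl)

theorem tailIdeal_zero : tailIdeal K n 0 = idealOfVars (Fin n) K := by
  simp only [tailIdeal, Nat.zero_le, Set.ofPred_true, Set.image_univ, idealOfVars]

theorem tailIdeal_eq_span_singleton_sup (k : Fin n) :
    tailIdeal K n k = Ideal.span {X k} ⊔ tailIdeal K n (k + 1) := by
  have hset : {l : Fin n | (k : ℕ) ≤ l} = insert k {l : Fin n | (k : ℕ) + 1 ≤ l} := by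
    ext l
    simp only [Set.mem_ofPred_eq, Set.mem_insert_iff, Fin.ext_iff]
    omega
  rw [tailIdeal, hset, Set.image_insert_eq, Ideal.span_insert, tailIdeal]

attribute [local instance] weightedGradedAlgebra in
theorem isHomogeneous_tailIdeal (k : ℕ) :
    (tailIdeal K n k).IsHomogeneous (weightedHomogeneousSubmodule K (1 : Fin n → ℤ)) := by
  refine Ideal.homogeneous_span _ _ ?_
  rintro _ ⟨l, -, rfl⟩
  exact ⟨1, isWeightedHomogeneous_X K _ l⟩

theorem mem_tailIdeal_of_X_mul_mem {k : Fin n} {f : S} (h : X k * f ∈ tailIdeal K n (k + 1)) :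
    f ∈ tailIdeal K n (k + 1) :=
  mem_span_X_image_of_X_mul_mem (s := {l : Fin n | (k : ℕ) + 1 ≤ l}) (Nat.not_succ_le_self k) h

theorem mem_tailIdeal_smul_top_of_X_smul_mem {r : ℕ} {k : Fin n} {v : Fin r → S}
    (h : (X k : S) • v ∈ (tailIdeal K n (k + 1) • ⊤ : Submodule S (Fin r → S))) :
    v ∈ (tailIdeal K n (k + 1) • ⊤ : Submodule S (Fin r → S)) := by
  rw [mem_smul_top_iff_forall_mem] at h ⊢
  exact fun b => mem_tailIdeal_of_X_mul_mem (h b)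

end TailIdeal

section Vanishing

attribute [local instance] weightedGradedAlgebra in
/-- The long exact `Tor` sequence of `x : S/J → S/J` with cokernel `S/(x, J)`: exactness of
`P_{i+1} → P_i → P_{i-1}` survives passage from `S/J` to `S/(x, J)` where `x` acts injectively on
the homology at `P_{i-1}`. -/
theorem mem_range_sup_smul_top_of_span_singleton_sup {q r s : ℕ} {w : Fin r → ℤ}
    {w' : Fin s → ℤ} {t m : ℤ} {d₁ : (Fin q → S) →ₗ[S] (Fin r → S)}
    {d₀ : (Fin r → S) →ₗ[S] (Fin s → S)} (hd₀ : IsHomogeneousMap w w' d₀) {J : Ideal S}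
    (hJ : J.IsHomogeneous (weightedHomogeneousSubmodule K (1 : Fin n → ℤ))) {x : S}
    (hx : x.IsWeightedHomogeneous (1 : Fin n → ℤ) m)
    (hexact : ∀ v, IsHomogeneousVec w v t → d₀ v ∈ (J • ⊤ : Submodule S (Fin s → S)) →
      v ∈ LinearMap.range d₁ ⊔ J • ⊤)
    (hinj : ∀ u, IsHomogeneousVec w' u (t - m) → x • u ∈ LinearMap.range d₀ ⊔ J • ⊤ →
      u ∈ LinearMap.range d₀ ⊔ J • ⊤)
    {v : Fin r → S} (hv : IsHomogeneousVec w v t)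
    (hdv : d₀ v ∈ ((Ideal.span {x} ⊔ J) • ⊤ : Submodule S (Fin s → S))) :
    v ∈ LinearMap.range d₁ ⊔ (Ideal.span {x} ⊔ J) • ⊤ := by
  have hJgraded := isGradedSubmodule_smul_top hJ w'
  obtain ⟨u, hu, hdvu⟩ : ∃ u, IsHomogeneousVec w' u (t - m) ∧ d₀ v - x • u ∈ J • ⊤ := by
    simp only [← isHomogeneousVec_add_const_iff]
    refine (isHomogeneousMap_lsmul hx w').exists_isHomogeneousVec_sub_mem hJgraded
      (hd₀.map hv) ?_
    rw [Submodule.sup_smul, Submodule.ideal_span_singleton_smul] at hdv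
    rw [LinearMap.range_eq_map]
    exact hdv
  have hxu : x • u ∈ LinearMap.range d₀ ⊔ J • ⊤ := by
    rw [← sub_sub_cancel (d₀ v) (x • u)]
    exact sub_mem (Submodule.mem_sup_left ⟨v, rfl⟩) (Submodule.mem_sup_right hdvu)
  obtain ⟨y, hy, huy⟩ := hd₀.exists_isHomogeneousVec_sub_mem hJgraded hu (hinj u hu hxu)
  have hvy : v - x • y ∈ LinearMap.range d₁ ⊔ J • ⊤ := by
    refine hexact _ (hv.sub (by simpa using hy.smul hx)) ?_
    have hsplit : d₀ (v - x • y) = d₀ v - x • u + x • (u - d₀ y) := by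
      rw [map_sub, map_smul, smul_sub, sub_add_sub_cancel]
    rw [hsplit]
    exact add_mem hdvu (Submodule.smul_mem _ x huy)
  rw [← sub_add_cancel v (x • y), Submodule.sup_smul, ← sup_assoc, sup_right_comm]
  refine Submodule.add_mem_sup hvy ?_
  exact Submodule.smul_mem_smul (Ideal.mem_span_singleton_self x) Submodule.mem_top

/-- On the graded module `M = (⨁_b S(-w b)) / Z`, the sequence `x_n, …, x_1` is regular in degrees
`≥ ρ`: multiplication by `x_k` on `M / (x_{k+1}, …, x_n) M` is injective in these degrees. -/
def IsRegularFrom {r : ℕ} (w : Fin r → ℤ) (Z : Submodule S (Fin r → S)) (ρ : ℤ) : Prop :=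
  ∀ (k : Fin n) (t : ℤ) (u : Fin r → S), ρ ≤ t → IsHomogeneousVec w u t →
    (X k : S) • u ∈ Z ⊔ tailIdeal K n (k + 1) • ⊤ → u ∈ Z ⊔ tailIdeal K n (k + 1) • ⊤

variable (K n) in
/-- An exact sequence `⋯ → P_2 → P_1 → P_0` of graded free modules of finite rank. -/
structure GradedRes where
  rank : ℕ → ℕ
  w : ∀ i, Fin (rank i) → ℤ
  d : ∀ i, (Fin (rank (i + 1)) → S) →ₗ[S] (Fin (rank i) → S)
  isHomogeneousMap_d : ∀ i, IsHomogeneousMap (w (i + 1)) (w i) (d i)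
  exact_d : ∀ i, Function.Exact (d (i + 1)) (d i)

theorem GradedRes.exact_mod_tailIdeal (P : GradedRes K n) {ρ : ℤ}
    (hρ : IsRegularFrom (P.w 0) (LinearMap.range (P.d 0)) ρ) {k : ℕ} (hk : k ≤ n) {i : ℕ} {t : ℤ}
    (ht : ρ + i < t) {v : Fin (P.rank (i + 1)) → S} (hv : IsHomogeneousVec (P.w (i + 1)) v t)
    (hdv : P.d i v ∈ (tailIdeal K n k • ⊤ : Submodule S (Fin (P.rank i) → S))) :
    v ∈ LinearMap.range (P.d (i + 1)) ⊔ tailIdeal K n k • ⊤ := by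
  induction hk using Nat.decreasingInduction generalizing i t v with
  | self =>
    rw [tailIdeal_self, Submodule.bot_smul, Submodule.mem_bot] at hdv
    exact Submodule.mem_sup_left ((P.exact_d i v).1 hdv)
  | of_succ k hkn ih =>
    obtain ⟨k, rfl⟩ : ∃ l : Fin n, (l : ℕ) = k := ⟨⟨k, hkn⟩, rfl⟩
    rw [tailIdeal_eq_span_singleton_sup] at hdv ⊢
    refine mem_range_sup_smul_top_of_span_singleton_sup (P.isHomogeneousMap_d i)
      (isHomogeneous_tailIdeal _) (isWeightedHomogeneous_X K _ k) (fun v => ih ht)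
      (fun u hu hxu => ?_) hv hdv
    obtain _ | i := i
    · exact hρ k _ u (by rw [Pi.one_apply]; omega) hu hxu
    · refine ih (by rw [Pi.one_apply]; omega) hu (mem_tailIdeal_smul_top_of_X_smul_mem ?_)
      rw [← map_smul]
      obtain ⟨_, ⟨y, rfl⟩, z, hz, hyz⟩ := Submodule.mem_sup.1 hxu
      rw [← hyz, map_add, (P.exact_d i).apply_apply_eq_zero, zero_add]
      exact Submodule.smul_top_le_comap_smul_top _ _ hz

end Vanishing

namespace MinGradedFreeRes

variable {I : Ideal (MvPolynomial (Fin n) K)} (F : MinGradedFreeRes I)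

/-- The resolution `⋯ → F_1 → F_0 → S` of `S/I` obtained by splicing `F` with `I → S`. -/
noncomputable def extend : GradedRes K n where
  rank
    | 0 => 1
    | i + 1 => F.rank i
  w
    | 0 => 0
    | i + 1 => F.w i
  d
    | 0 => LinearMap.pi fun _ => I.subtype ∘ₗ F.aug
    | i + 1 => F.d i
  isHomogeneousMap_d
    | 0 => fun a _ e he => (add_zero _).trans (F.aug_homogeneous a e he)
    | i + 1 => F.d_homogeneous i
  exact_d
    | 0 => fun v => by
      refine Iff.trans ?_ (F.exact_zero v)
      rw [Subtype.ext_iff, funext_iff, Fin.forall_fin_one]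
      rfl
    | i + 1 => F.exact_succ i

theorem range_extend_d_zero :
    LinearMap.range (F.extend.d 0) = (I • ⊤ : Submodule S (Fin 1 → S)) := by
  refine Submodule.ext fun v : Fin 1 → S => Iff.trans ?_ mem_smul_top_iff_forall_mem.symm
  rw [Fin.forall_fin_one]
  refine ⟨?_, fun hv => ?_⟩
  · rintro ⟨y, rfl⟩
    exact (F.aug y).2
  · obtain ⟨y, hy⟩ := F.aug_surjective ⟨v 0, hv⟩
    exact ⟨y, funext <| Fin.forall_fin_one.2 (congrArg Subtype.val hy)⟩

theorem range_d_le (i : ℕ) : LinearMap.range (F.d i) ≤ idealOfVars (Fin n) K • ⊤ := by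
  rintro _ ⟨v, rfl⟩
  exact mem_smul_top_iff_forall_mem.2 (F.minimal i v)

theorem aug_single_mem_idealOfVars {a : Fin (F.rank 0)} (ha : F.w 0 a ≠ 0) :
    (F.aug (Pi.single a 1) : S) ∈ idealOfVars (Fin n) K := by
  rw [mem_idealOfVars_iff_coeff_zero]
  by_contra h0
  exact ha (by simpa using (F.aug_homogeneous a 0 (mem_support_iff.2 h0)).symm)

theorem w_le {ρ : ℤ} (hρ : 0 ≤ ρ)
    (hreg : IsRegularFrom (0 : Fin 1 → ℤ) (I • ⊤ : Submodule S (Fin 1 → S)) ρ) (i : ℕ)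
    (a : Fin (F.rank i)) : F.w i a ≤ ρ + i := by
  by_contra! hlt
  have hcycle : F.extend.d i (Pi.single a (1 : S)) ∈
      (tailIdeal K n 0 • ⊤ : Submodule S (Fin (F.extend.rank i) → S)) := by
    rw [tailIdeal_zero]
    obtain _ | i := i
    · exact mem_smul_top_iff_forall_mem.2 fun _ => F.aug_single_mem_idealOfVars (by omega)
    · exact F.range_d_le i ⟨_, rfl⟩
  rw [← F.range_extend_d_zero] at hreg
  have hboundary := F.extend.exact_mod_tailIdeal hreg n.zero_le hlt
    (isHomogeneousVec_single (F.w i) a) hcycle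
  -- Both boundaries and `(x_1, …, x_n) F_i` miss the basis vectors of `F_i`, by minimality.
  rw [tailIdeal_zero] at hboundary
  have hsingle := mem_smul_top_iff_forall_mem.1 (sup_le (F.range_d_le i) le_rfl hboundary) a
  rw [Pi.single_eq_same, mem_idealOfVars_iff_coeff_zero, coeff_zero_one] at hsingle
  exact one_ne_zero hsingle

theorem nonempty_fin_rank_zero (hI : I ≠ ⊥) : Nonempty (Fin (F.rank 0)) := by
  by_contra hempty
  rw [not_nonempty_iff] at hempty
  refine hI ((Submodule.eq_bot_iff I).2 fun f hf => ?_)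
  obtain ⟨v, hv⟩ := F.aug_surjective ⟨f, hf⟩
  rw [Subsingleton.elim v 0, map_zero] at hv
  exact (congrArg Subtype.val hv).symm

theorem betti_ne_zero_iff {i : ℕ} {j : ℤ} : F.betti i j ≠ 0 ↔ ∃ a, F.w i a = j := by
  rw [betti, ← Nat.pos_iff_ne_zero, Fintype.card_pos_iff, nonempty_subtype]

theorem exists_isReg_le (hI : I ≠ ⊥) {ρ : ℤ} (hw : ∀ i a, F.w i a ≤ ρ + i) :
    ∃ r, F.IsReg r ∧ r ≤ ρ := by
  have hbound : ∀ t, (∃ (i : ℕ) (j : ℤ), F.betti i j ≠ 0 ∧ t = j - i) → t ≤ ρ := by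
    rintro _ ⟨i, j, hij, rfl⟩
    obtain ⟨a, rfl⟩ := F.betti_ne_zero_iff.1 hij
    exact sub_le_iff_le_add.2 (hw i a)
  obtain ⟨a⟩ := F.nonempty_fin_rank_zero hI
  obtain ⟨r, hr, hmax⟩ := Int.exists_greatest_of_bdd ⟨ρ, hbound⟩
    ⟨_, 0, _, F.betti_ne_zero_iff.2 ⟨a, rfl⟩, rfl⟩
  exact ⟨r, ⟨hr, hmax⟩, hbound r hr⟩

end MinGradedFreeRes

section BorelType

variable {I J : Ideal (MvPolynomial (Fin n) K)}

namespace IsMonomialIdeal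

theorem mem_iff (hI : IsMonomialIdeal I) {f : S} :
    f ∈ I ↔ ∀ e ∈ f.support, monomial e (1 : K) ∈ I := by
  obtain ⟨A, rfl⟩ := hI
  rw [mem_ideal_span_monomial_image]
  simp only [monomial_mem_span_monomial_image]

theorem sup (hI : IsMonomialIdeal I) (hJ : IsMonomialIdeal J) : IsMonomialIdeal (I ⊔ J) := by
  obtain ⟨A, rfl⟩ := hI
  obtain ⟨B, rfl⟩ := hJ
  exact ⟨A ∪ B, by rw [Set.image_union, Ideal.span_union]⟩

theorem monomial_mem_sup_iff (hI : IsMonomialIdeal I) (hJ : IsMonomialIdeal J) {e : Fin n →₀ ℕ} :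
    monomial e (1 : K) ∈ I ⊔ J ↔ monomial e (1 : K) ∈ I ∨ monomial e (1 : K) ∈ J := by
  obtain ⟨A, rfl⟩ := hI
  obtain ⟨B, rfl⟩ := hJ
  simp only [← Ideal.span_union, ← Set.image_union, monomial_mem_span_monomial_image,
    Set.mem_union, or_and_right, exists_or]

attribute [local instance] weightedGradedAlgebra in
theorem isHomogeneous (hI : IsMonomialIdeal I) :
    I.IsHomogeneous (weightedHomogeneousSubmodule K (1 : Fin n → ℤ)) := by
  obtain ⟨A, rfl⟩ := hI
  refine Ideal.homogeneous_span _ _ ?_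
  rintro _ ⟨a, -, rfl⟩
  exact ⟨_, isWeightedHomogeneous_monomial _ a 1 rfl⟩

end IsMonomialIdeal

theorem isMonomialIdeal_tailIdeal (k : ℕ) : IsMonomialIdeal (tailIdeal K n k) :=
  ⟨(fun l => Finsupp.single l 1) '' {l | k ≤ l}, by rw [Set.image_image]; rfl⟩

theorem monomial_mem_tailIdeal {k : ℕ} {e : Fin n →₀ ℕ} {l : Fin n} (hkl : k ≤ l) (hl : e l ≠ 0) :
    monomial e (1 : K) ∈ tailIdeal K n k :=
  monomial_mem_of_le (Finsupp.single_le_iff.2 (Nat.one_le_iff_ne_zero.2 hl))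
    (Ideal.subset_span (Set.mem_image_of_mem X hkl))

theorem minGens_finite (I : Ideal S) : (minGens I).Finite :=
  WellQuasiOrderedLE.finite_of_isAntichain (setOfPred_minimal_antichain _)

theorem exists_minGens_le {e : Fin n →₀ ℕ} (he : monomial e (1 : K) ∈ I) :
    ∃ v ∈ minGens I, v ≤ e := by
  obtain ⟨v, hve, hv⟩ := exists_minimal_le_of_wellFoundedLT (fun b => monomial b (1 : K) ∈ I) e he
  exact ⟨v, hv, hve⟩

theorem degree_le_degI {v : Fin n →₀ ℕ} (hv : v ∈ minGens I) : v.degree ≤ degI I :=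
  le_csSup ((minGens_finite I).image _).bddAbove ⟨v, hv, rfl⟩

theorem lt_mI {v : Fin n →₀ ℕ} (hv : v ∈ minGens I) {k : Fin n} (hk : v k ≠ 0) : (k : ℕ) < mI I :=
  (Finset.le_sup (f := fun i : Fin n => (i : ℕ) + 1) (Finsupp.mem_support_iff.2 hk)).trans
    (le_csSup ((minGens_finite I).image _).bddAbove ⟨v, hv, rfl⟩)

theorem mI_eq_zero_of_degI_eq_zero (h : degI I = 0) : mI I = 0 := by
  refine Nat.le_zero.1 (csSup_le' ?_)
  rintro _ ⟨v, hv, rfl⟩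
  have hv0 : v = 0 := (Finsupp.degree_eq_zero_iff v).1 (Nat.le_zero.1 (h ▸ degree_le_degI hv))
  rw [hv0, mMon, Finsupp.support_zero, Finset.sup_empty, bot_eq_zero]

theorem mI_mul_degI_sub_one_nonneg (I : Ideal S) : (0 : ℤ) ≤ mI I * (degI I - 1) := by
  obtain h | h := Nat.eq_zero_or_pos (degI I)
  · rw [mI_eq_zero_of_degI_eq_zero h, Nat.cast_zero, zero_mul]
  · exact mul_nonneg (Nat.cast_nonneg _) (by omega)

theorem exists_lt_apply_of_mul_lt_degree {e : Fin n →₀ ℕ} {k : Fin n}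
    (hsupp : ∀ i, k < i → e i = 0) {D : ℕ} (hdeg : (k + 1) * D < e.degree) :
    ∃ i ≤ k, D < e i := by
  have hsum : ∑ _ ∈ Finset.Iic k, D < ∑ i ∈ Finset.Iic k, e i := by
    rwa [Finset.sum_const, Fin.card_Iic, smul_eq_mul,
      Finset.sum_subset (Finset.subset_univ _) (by simpa using hsupp),
      ← Finsupp.degree_eq_sum]
  obtain ⟨i, hi, hlt⟩ := Finset.exists_lt_of_sum_lt hsum
  exact ⟨i, Finset.mem_Iic.1 hi, hlt⟩

namespace IsBorelType

theorem exists_erase_add_single_mem (hB : IsBorelType I) {v : Fin n →₀ ℕ}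
    (hv : monomial v (1 : K) ∈ I) {i k : Fin n} (hik : i ≤ k) :
    ∃ t : ℕ, monomial (v.erase k + Finsupp.single i t) (1 : K) ∈ I := by
  have hsat : monomial (v.erase k) (1 : K) ∈ saturation I (Ideal.span {X k}) := by
    refine Submodule.mem_iSup_of_mem (v k) (Submodule.mem_colon.2 fun s hs => ?_)
    rw [SetLike.mem_coe, Ideal.span_singleton_pow, Ideal.mem_span_singleton'] at hs
    obtain ⟨c, rfl⟩ := hs
    rw [smul_eq_mul, mul_left_comm, X_pow_eq_monomial, monomial_mul, one_mul,
      Finsupp.erase_add_single]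
    exact I.mul_mem_left _ hv
  rw [hB.2 k, saturation, Submodule.mem_iSup_of_directed _ (directed_colon_pow I _)] at hsat
  obtain ⟨t, ht⟩ := hsat
  have hmem := Submodule.mem_colon.1 ht (X i ^ t)
    (Ideal.pow_mem_pow (Ideal.subset_span (Set.mem_image_of_mem X (Set.mem_Iic.2 hik))) t)
  rw [smul_eq_mul, X_pow_eq_monomial, monomial_mul, one_mul] at hmem
  exact ⟨t, hmem⟩

theorem monomial_mem_of_degI_le (hB : IsBorelType I) {v e : Fin n →₀ ℕ}
    (hv : monomial v (1 : K) ∈ I) {i k : Fin n} (hik : i ≤ k) (hi : degI I ≤ e i)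
    (hve : ∀ j, j ≠ k → v j ≤ e j) : monomial e (1 : K) ∈ I := by
  obtain ⟨t, ht⟩ := hB.exists_erase_add_single_mem hv hik
  obtain ⟨u, hu, hut⟩ := exists_minGens_le ht
  refine monomial_mem_of_le (fun j => ?_) hu.1
  obtain rfl | hji := eq_or_ne j i
  · exact ((Finsupp.le_degree j u).trans (degree_le_degI hu)).trans hi
  · have huj : u j ≤ v.erase k j := by simpa [Finsupp.single_eq_of_ne hji] using hut j
    obtain rfl | hjk := eq_or_ne j k
    · exact huj.trans (by rw [Finsupp.erase_same]; exact Nat.zero_le _)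
    · exact huj.trans (by rw [Finsupp.erase_ne hjk]; exact hve j hjk)

theorem monomial_mem_of_add_single (hB : IsBorelType I) {e : Fin n →₀ ℕ} {k : Fin n}
    (hsupp : ∀ i, k < i → e i = 0) (hdeg : (mI I : ℤ) * (degI I - 1) + 1 ≤ e.degree)
    (he : monomial (Finsupp.single k 1 + e) (1 : K) ∈ I) : monomial e (1 : K) ∈ I := by
  obtain ⟨v, hv, hve⟩ := exists_minGens_le he
  have hve' (j : Fin n) (hj : j ≠ k) : v j ≤ e j := by
    simpa [Finsupp.single_eq_of_ne hj] using hve j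
  by_cases hvk : v k ≤ e k
  · refine monomial_mem_of_le (fun j => ?_) hv.1
    obtain rfl | hj := eq_or_ne j k
    exacts [hvk, hve' j hj]
  · have hk : (k : ℕ) < mI I := lt_mI hv (by omega)
    have hvdeg : v k ≤ degI I := (Finsupp.le_degree k v).trans (degree_le_degI hv)
    obtain ⟨D, hD⟩ : ∃ D, degI I = D + 1 := Nat.exists_eq_add_one.2 (by omega)
    have hlt : (k + 1) * D < e.degree := by
      rw [hD, Nat.cast_succ, add_sub_cancel_right] at hdeg
      exact (Nat.mul_le_mul_right D hk).trans_lt (by exact_mod_cast hdeg)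
    obtain ⟨i, hik, hi⟩ := exists_lt_apply_of_mul_lt_degree hsupp hlt
    exact hB.monomial_mem_of_degI_le hv.1 hik (hD ▸ hi) hve'

theorem mem_sup_tailIdeal_of_X_mul_mem (hB : IsBorelType I) {k : Fin n} {t : ℤ}
    (ht : (mI I : ℤ) * (degI I - 1) + 1 ≤ t) {f : S}
    (hf : f.IsWeightedHomogeneous (1 : Fin n → ℤ) t)
    (h : X k * f ∈ I ⊔ tailIdeal K n (k + 1)) : f ∈ I ⊔ tailIdeal K n (k + 1) := by
  have htail := isMonomialIdeal_tailIdeal (K := K) (n := n) (k + 1)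
  rw [(hB.1.sup htail).mem_iff] at h ⊢
  intro e he
  have hXe := h (Finsupp.single k 1 + e) (by
    rwa [mem_support_iff, coeff_X_mul, ← mem_support_iff])
  by_cases hsupp : ∃ l, k < l ∧ e l ≠ 0
  · obtain ⟨l, hkl, hl⟩ := hsupp
    exact Ideal.mem_sup_right (monomial_mem_tailIdeal hkl hl)
  push Not at hsupp
  obtain hXI | hXT := (hB.1.monomial_mem_sup_iff htail).1 hXe
  · refine Ideal.mem_sup_left (hB.monomial_mem_of_add_single hsupp ?_ hXI)
    rwa [← weight_one_eq_degree, hf (mem_support_iff.1 he)]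
  · rw [← one_mul (1 : K), ← monomial_mul] at hXT
    exact Ideal.mem_sup_right (mem_tailIdeal_of_X_mul_mem hXT)

theorem isRegularFrom (hB : IsBorelType I) :
    IsRegularFrom (0 : Fin 1 → ℤ) (I • ⊤ : Submodule S (Fin 1 → S))
      (mI I * (degI I - 1) + 1) := by
  intro k t u ht hu hXu
  rw [← Submodule.sup_smul, mem_smul_top_iff_forall_mem] at hXu ⊢
  refine fun b => hB.mem_sup_tailIdeal_of_X_mul_mem ht ?_ (hXu b)
  simpa using isHomogeneousVec_iff.1 hu b

end IsBorelType

end BorelType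

end BorelReg

theorem corollary2p4 {K : Type*} [Field K] {n : ℕ} (I : Ideal (MvPolynomial (Fin n) K))
    (hI : I ≠ ⊥) (hB : BorelReg.IsBorelType I) :
    Nonempty (BorelReg.MinGradedFreeRes I) ∧
      ∀ F : BorelReg.MinGradedFreeRes I, ∃ r : ℤ, F.IsReg r ∧
        r ≤ (BorelReg.mI I : ℤ) * ((BorelReg.degI I : ℤ) - 1) + 1 := by
  refine ⟨BorelReg.nonempty_minGradedFreeRes hB.1.isHomogeneous, fun F => ?_⟩
  have hρ : (0 : ℤ) ≤ BorelReg.mI I * (BorelReg.degI I - 1) + 1 :=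
    add_nonneg (BorelReg.mI_mul_degI_sub_one_nonneg I) zero_le_one
  exact F.exists_isReg_le hI (F.w_le hρ hB.isRegularFrom)
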